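/- Let $\mathcal S$ be the class of all positive nondecreasing sequences $\Lambda=\{\lambda_n\}_{n\ge1}$ with $\lambda_n\to\infty$ and $\sum_n 1/\lambda_n=\infty$. For a $1$-periodic function $f:\mathbb R\to\mathbb R$ put $$v_\Lambda(f)=\sup\sum_{n=1}^\infty\frac{|f(b_n)-f(a_n)|}{\lambda_n},$$ the supremum being taken over all sequences of nonoverlapping intervals $[a_n,b_n]$ (possibly degenerate) contained in a period. For $1\le p<\infty$ and $f\in L^p$ (1-periodic, measurable, $\int_0^1|f|^p<\infty$) let $$\omega(f;\delta)_p=\sup_{0\le h\le\delta}\Big(\int_0^1|f(x+h)-f(x)|^p\,dx\Big)^{1/p}\quad(0\le\delta\le1),\qquad \|f\|_{\mathrm{Lip}(\alpha;p)}=\sup_{0<\delta\le1}\frac{\omega(f;\delta)_p}{\delta^\alpha},$$ and let $\mathrm{Lip}(\alpha;p)$ be the class of $f\in L^p$ with $\omega(f;\delta)_p=O(\delta^\alpha)$. **Theorem.** Let $1<p<\infty$, $1/p<\alpha<1$, $p'=p/(p-1)$ and $r'=1/(1+1/p-\alpha)$. There is a constant $c_{p,\alpha}>0$ depending only on $p$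 and $\alpha$ such that for every $\Lambda\in\mathcal S$ and every $f\in\mathrm{Lip}(\alpha;p)$, the function $f$ agrees almost everywhere with a continuous $1$-periodic function $\bar f$ for which $$v_\Lambda(\bar f)\le c_{p,\alpha}\,\|f\|_{\mathrm{Lip}(\alpha;p)}\left(\sum_{n=0}^\infty\left(\sum_{k=2^n}^{2^{n+1}}\left(\frac1{k^{\alpha-1/p}\lambda_k}\right)^{p'}\right)^{r'/p'}\right)^{1/r'},$$ both sides being allowed to be $+\infty$ (with $0\cdot\infty=0$). -/

import Mathlib

open MeasureTheory Set Filter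
open scoped ENNReal NNReal Topology

namespace LambdaBV

/-- The class `S` of sequences `lam 1, lam 2, ...`, positive, nondecreasing, tending to infinity,
with divergent sum of reciprocals. The value `lam 0` plays no role. -/
structure IsWatermanSeq (lam : ℕ → ℝ) : Prop where
  pos : ∀ n, 1 ≤ n → 0 < lam n
  mono : ∀ m n, 1 ≤ m → m ≤ n → lam m ≤ lam n
  tendsto : Tendsto lam atTop atTop
  diverges : ¬ Summable (fun n : ℕ => 1 / lam (n + 1))

/-- A sequence of nonoverlapping closed intervals `[left n, right n]` contained in a period
`[t, t + 1]`. Degenerate intervals are allowed; they contribute nothing to the variation, so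
finite families are included. -/
structure IntervalSeq where
  left : ℕ → ℝ
  right : ℕ → ℝ
  le : ∀ n, left n ≤ right n
  period : ∃ t : ℝ, ∀ n, Icc (left n) (right n) ⊆ Icc t (t + 1)
  nonoverlapping : Pairwise fun m n =>
    Disjoint (interior (Icc (left m) (right m))) (interior (Icc (left n) (right n)))

/-- The `Λ`-variation `v_Λ(f)`. The intervals are indexed from `0`, so that the interval number `n`
is weighted by `lam (n + 1)`. -/
noncomputable def lambdaVariation (lam : ℕ → ℝ) (f : ℝ → ℝ) : ℝ≥0∞ :=
  ⨆ I : IntervalSeq, ∑' n : ℕ, ENNReal.ofReal (|f (I.right n) - f (I.left n)| / lam (n + 1))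

/-- The `L^p`-modulus of continuity `ω(f; δ)_p` of a 1-periodic function. -/
noncomputable def modulus (p : ℝ) (f : ℝ → ℝ) (δ : ℝ) : ℝ≥0∞ :=
  ⨆ h ∈ Icc (0 : ℝ) δ,
    eLpNorm (fun x => f (x + h) - f x) (ENNReal.ofReal p) (volume.restrict (Ioc (0 : ℝ) 1))

/-- Membership in `Lip(α; p)`: `f` is 1-periodic, in `L^p` over a period, and
`ω(f; δ)_p = O(δ^α)` on `[0, 1]`. -/
structure MemLip (α p : ℝ) (f : ℝ → ℝ) : Prop where
  periodic : Function.Periodic f 1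
  memLp : MemLp f (ENNReal.ofReal p) (volume.restrict (Ioc (0 : ℝ) 1))
  modulus_le : ∃ C : ℝ≥0, ∀ δ ∈ Icc (0 : ℝ) 1, modulus p f δ ≤ C * ENNReal.ofReal (δ ^ α)

/-- `‖f‖_{Lip(α; p)}`, the supremum of `ω(f; δ)_p / δ^α` over the positive `δ` in the domain
`[0, 1]` of the modulus (by periodicity, larger `δ` would not change the supremum). -/
noncomputable def lipNorm (α p : ℝ) (f : ℝ → ℝ) : ℝ≥0∞ :=
  ⨆ δ ∈ Ioc (0 : ℝ) 1, modulus p f δ / ENNReal.ofReal (δ ^ α)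

end LambdaBV

/-!
Put `θ = α - 1 / p`, `M = ‖f‖_{Lip(α; p)}` and `w k = 1 / λ_k`.

Halving the window of the Steklov mean of `f` from `2h` to `h` changes it by at most `M h ^ θ`
(`dist_steklov_le`), so these means converge uniformly to a continuous representative `g`
(`exists_continuous_periodic_ae_eq`).

For an interval `I` let `E(I)` be the integral over `I × I` of
`|g x - g y| ^ p / |x - y| ^ (2 + β p)` with `β = θ / 2`. Comparing `g` at both endpoints of `I`
with its mean over `I`, through the means over successively halved intervals, gives
`|g b - g a| ≤ C |I| ^ β E(I) ^ (1 / p)` (`ofReal_abs_sub_le_gagliardo`). The squares `I × I` of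
disjoint intervals of length at most `h` are disjoint and lie in a strip of width `h` around the
diagonal, whose energy is `O(M ^ p h ^ ((θ - β) p))` (`lintegral_strip_gagliardo_le`). Hence the
`ℓ^p` norm of the increments of `g` over the intervals of level `j`, those with length in
`(2 ^ (-j - 1), 2 ^ (-j)]`, is at most `C M 2 ^ (-j θ)` (`sum_abs_sub_rpow_le`).

Let `N_j` be the number of intervals of level `j`; the total length being at most one,
`∑ N_j 2 ^ (-j) ≤ 2`. By Hölder's inequality and the monotonicity of `w`, level `j` contributes at
most `C M 2 ^ (-j θ)` times the sum, over the `n` with `2 ^ n ≤ N_j`, of the `ℓ^{p'}` norms `L_n` of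
`w` on the dyadic blocks. In the sum over all levels, `L_n` gets the coefficient
`∑ 2 ^ (-j θ)` over the `j` with `N_j ≥ 2 ^ n`, and this is at most `C (∑ 2 ^ (-j)) ^ θ` over the same
`j`, both sums being comparable to their largest term. Hölder's inequality with the exponents
`r' = 1 / (1 - θ)` and `1 / θ` then leaves `∑_n 2 ^ n ∑_{j : N_j ≥ 2 ^ n} 2 ^ (-j)`, which is at most
`2 ∑ N_j 2 ^ (-j) ≤ 4` (`sum_mul_le_of_levels`).
-/

namespace LambdaBV

/-! ### Steklov means and the continuous representative -/

/-- Jensen's inequality in the unnormalised form given by Hölder. -/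
lemma lintegral_enorm_le_rpow_mul_measure {X : Type*} [MeasurableSpace X] {μ : Measure X} {φ : X → ℝ}
    (hφ : AEStronglyMeasurable φ μ) {p : ℝ} (hp : 1 ≤ p) :
    ∫⁻ x, ‖φ x‖ₑ ∂μ ≤ (∫⁻ x, ‖φ x‖ₑ ^ p ∂μ) ^ (1 / p) * μ univ ^ (1 - 1 / p) := by
  have h := eLpNorm_le_eLpNorm_mul_rpow_measure_univ (μ := μ) (f := φ) (p := 1)
    (q := ENNReal.ofReal p) (by simpa using hp) hφ
  have hp0 : 0 < p := by linarith
  rw [eLpNorm_one_eq_lintegral_enorm, eLpNorm_eq_lintegral_rpow_enorm_toReal (by simpa using hp0)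
    ENNReal.ofReal_ne_top, ENNReal.toReal_ofReal hp0.le] at h
  simpa using h

lemma setLIntegral_Ioc_eq_of_periodic {φ : ℝ → ℝ≥0∞} (hφ : Function.Periodic φ 1) (s t : ℝ) :
    ∫⁻ x in Ioc s (s + 1), φ x = ∫⁻ x in Ioc t (t + 1), φ x := by
  refine (isAddFundamentalDomain_Ioc one_pos s).setLIntegral_eq
    (isAddFundamentalDomain_Ioc one_pos t) φ ?_
  rintro ⟨_, n, rfl⟩ x
  have := (hφ.zsmul n) x
  rw [← this]
  simp [AddSubgroup.vadd_def, add_comm]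

/-- The average of `f` over the interval with endpoints `x` and `x + h`. The sign of `h` selects the
side of `x`, so that one definition serves both endpoints of an interval. -/
noncomputable def steklov (f : ℝ → ℝ) (h x : ℝ) : ℝ := h⁻¹ * ∫ u in x..x + h, f u

/-- Halving the window changes the Steklov mean by an average of differences with the single
shift `h`. -/
lemma steklov_two_mul_sub {f : ℝ → ℝ} (hf : ∀ a b, IntervalIntegrable f volume a b) {h : ℝ}
    (hh : 0 < h) (x : ℝ) :
    steklov f (2 * h) x - steklov f h x = (2 * h)⁻¹ * ∫ u in x..x + h, (f (u + h) - f u) := by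
  have h1 : ∫ u in x..x + h, f (u + h) = ∫ u in x + h..x + 2 * h, f u := by
    rw [intervalIntegral.integral_comp_add_right]; ring_nf
  have h2 : IntervalIntegrable (fun u => f (u + h)) volume x (x + h) := by
    have := (hf (x + h) (x + h + h)).comp_add_right h
    simpa using this
  rw [intervalIntegral.integral_sub h2 (hf _ _), h1, steklov, steklov,
    ← intervalIntegral.integral_add_adjacent_intervals (hf x (x + h)) (hf (x + h) (x + 2 * h))]
  field_simp
  ring

lemma dist_steklov_le {f : ℝ → ℝ} (hf : ∀ a b, IntervalIntegrable f volume a b)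
    (hper : Function.Periodic f 1) {p α : ℝ} (hp : 1 < p) {M : ℝ≥0}
    (hM : ∀ h ∈ Ioc (0 : ℝ) 1, ∫⁻ x in Ioc (0 : ℝ) 1, ‖f (x + h) - f x‖ₑ ^ p ≤
      (M * ENNReal.ofReal (h ^ α)) ^ p) {h : ℝ} (hh : h ∈ Ioc (0 : ℝ) 1) (x : ℝ) :
    dist (steklov f (2 * h) x) (steklov f h x) ≤ M * h ^ (α - 1 / p) := by
  have hp0 : 0 < p := by linarith
  have h0 : 0 < h := hh.1
  rw [Real.dist_eq, steklov_two_mul_sub hf h0, abs_mul, abs_of_pos (by positivity)]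
  have hmeas : AEStronglyMeasurable (fun u => f (u + h) - f u)
      (volume.restrict (Ioc x (x + h))) := by
    have h2 : IntervalIntegrable (fun u => f (u + h)) volume x (x + h) := by
      have := (hf (x + h) (x + h + h)).comp_add_right h
      simpa using this
    exact (h2.sub (hf _ _)).aestronglyMeasurable
  have key : ENNReal.ofReal |∫ u in x..x + h, (f (u + h) - f u)| ≤
      ENNReal.ofReal (M * h ^ α * h ^ (1 - 1 / p)) := by
    rw [← Real.enorm_eq_ofReal_abs, intervalIntegral.integral_of_le (by linarith)]
    refine (enorm_integral_le_lintegral_enorm _).trans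
      ((lintegral_enorm_le_rpow_mul_measure hmeas hp.le).trans ?_)
    have hsub : ∫⁻ u in Ioc x (x + h), ‖f (u + h) - f u‖ₑ ^ p ≤
        (M * ENNReal.ofReal (h ^ α)) ^ p := by
      refine (lintegral_mono_set (Ioc_subset_Ioc_right (by linarith [hh.2] :
        x + h ≤ x + 1))).trans ?_
      have hp1 : Function.Periodic (fun u => ‖f (u + h) - f u‖ₑ ^ p) 1 := fun u => by
        simp only
        rw [add_right_comm, hper, hper]
      rw [setLIntegral_Ioc_eq_of_periodic hp1 x 0]
      simpa using hM h hh
    calc _ ≤ ((M * ENNReal.ofReal (h ^ α)) ^ p) ^ (1 / p) *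
          (ENNReal.ofReal h) ^ (1 - 1 / p) := by
          gcongr
          · exact sub_nonneg.2 ((div_le_one hp0).2 hp.le)
          · simp
      _ = _ := by
          rw [← ENNReal.rpow_mul, mul_one_div_cancel hp0.ne', ENNReal.rpow_one,
            ENNReal.ofReal_rpow_of_pos h0, mul_assoc, ← ENNReal.ofReal_mul (by positivity),
            mul_assoc, ENNReal.ofReal_mul M.coe_nonneg]
          simp
  have key' := (ENNReal.ofReal_le_ofReal_iff (by positivity)).1 key
  calc (2 * h)⁻¹ * |∫ u in x..x + h, (f (u + h) - f u)|
      ≤ h⁻¹ * (M * h ^ α * h ^ (1 - 1 / p)) := by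
        gcongr
        linarith
    _ = M * h ^ (α - 1 / p) := by
        rw [mul_assoc, ← Real.rpow_add h0, mul_left_comm, ← Real.rpow_neg_one h,
          ← Real.rpow_add h0]
        ring_nf

/-- A periodic function with modulus of continuity `O(δ ^ α)` in `L^p`, where `α > 1 / p`, has a
continuous periodic representative, the uniform limit of its Steklov means. -/
lemma exists_continuous_periodic_ae_eq {f : ℝ → ℝ} (hf : ∀ a b, IntervalIntegrable f volume a b)
    (hper : Function.Periodic f 1) {p α : ℝ} (hp : 1 < p) (hα : 1 / p < α) {M : ℝ≥0}
    (hM : ∀ h ∈ Ioc (0 : ℝ) 1, ∫⁻ x in Ioc (0 : ℝ) 1, ‖f (x + h) - f x‖ₑ ^ p ≤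
      (M * ENNReal.ofReal (h ^ α)) ^ p) :
    ∃ g : ℝ → ℝ, Continuous g ∧ Function.Periodic g 1 ∧ f =ᵐ[volume] g := by
  set θ := α - 1 / p with hθ
  have hθ0 : 0 < θ := sub_pos.2 hα
  set q : ℝ := (1 / 2 : ℝ) ^ θ with hq
  have hq1 : q < 1 := Real.rpow_lt_one (by norm_num) (by norm_num) hθ0
  have hq0 : 0 < q := by positivity
  let F : ℕ → ℝ → ℝ := fun n x => steklov f ((1 / 2) ^ n) x
  have hF : ∀ x n, dist (F n x) (F (n + 1) x) ≤ M * q * q ^ n := fun x n => by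
    have h1 : ((1 / 2 : ℝ) ^ (n + 1)) ∈ Ioc (0 : ℝ) 1 :=
      ⟨by positivity, pow_le_one₀ (by norm_num) (by norm_num)⟩
    have := dist_steklov_le hf hper hp hM h1 x
    have h2 : 2 * (1 / 2 : ℝ) ^ (n + 1) = (1 / 2) ^ n := by rw [pow_succ]; ring
    rw [h2] at this
    refine this.trans_eq ?_
    rw [mul_assoc, ← pow_succ', hq, ← hθ, ← Real.rpow_natCast, ← Real.rpow_natCast,
      ← Real.rpow_mul (by norm_num), ← Real.rpow_mul (by norm_num), mul_comm θ]
  choose g hg using fun x => cauchySeq_tendsto_of_complete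
    (cauchySeq_of_le_geometric q (M * q) hq1 (hF x))
  have hFc : ∀ n, Continuous (F n) := fun n => by
    have hP := intervalIntegral.continuous_primitive (μ := volume) (f := f) (fun a b => hf a b) 0
    have : F n = fun x => ((1 / 2 : ℝ) ^ n)⁻¹ *
        ((∫ u in (0 : ℝ)..x + (1 / 2) ^ n, f u) - ∫ u in (0 : ℝ)..x, f u) := by
      ext x
      rw [intervalIntegral.integral_interval_sub_left (hf _ _) (hf _ _)]
      rfl
    rw [this]
    exact continuous_const.mul ((hP.comp (continuous_id.add continuous_const)).sub hP)
  have hunif : TendstoUniformly F g atTop := by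
    rw [Metric.tendstoUniformly_iff]
    intro ε hε
    have hlim : Tendsto (fun n : ℕ => M * q * q ^ n / (1 - q)) atTop (𝓝 0) := by
      have := (tendsto_pow_atTop_nhds_zero_of_lt_one hq0.le hq1).const_mul (M * q)
      simpa using this.div_const (1 - q)
    filter_upwards [hlim.eventually (gt_mem_nhds hε)] with n hn x
    rw [dist_comm]
    exact (dist_le_of_le_geometric_of_tendsto q (M * q) hq1 (hF x) (hg x) n).trans_lt hn
  refine ⟨g, hunif.continuous (Eventually.of_forall hFc).frequently, fun x => ?_, ?_⟩
  · refine tendsto_nhds_unique (hg (x + 1)) ?_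
    have : ∀ n, F n (x + 1) = F n x := fun n => by
      have h1 := intervalIntegral.integral_comp_add_right (a := x) (b := x + (1 / 2) ^ n) f 1
      simp only [hper _] at h1
      simp only [F, steklov]
      rw [h1, add_right_comm]
    simpa only [this] using hg x
  -- Almost every `x` is a point where the primitive of `f` has derivative `f x`.
  · have hloc : LocallyIntegrable f volume := by
      rw [locallyIntegrable_iff]
      intro K hK
      obtain ⟨a, ha⟩ := hK.bddBelow
      obtain ⟨b, hb⟩ := hK.bddAbove
      have h1 : IntegrableOn f (Icc a (max a b)) := by
        rw [integrableOn_Icc_iff_integrableOn_Ioc]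
        exact (intervalIntegrable_iff_integrableOn_Ioc_of_le (le_max_left _ _)).1 (hf _ _)
      exact h1.mono_set fun x hx => ⟨ha hx, (hb hx).trans (le_max_right _ _)⟩
    filter_upwards [LocallyIntegrable.ae_hasDerivAt_integral hloc] with x hx
    have h1 := (hasDerivAt_iff_tendsto_slope_zero.1 (hx 0))
    have h2 : Tendsto (fun n : ℕ => (1 / 2 : ℝ) ^ n) atTop (𝓝[≠] 0) :=
      tendsto_nhdsWithin_iff.2 ⟨tendsto_pow_atTop_nhds_zero_of_lt_one (by norm_num) (by norm_num),
        Eventually.of_forall fun n => by simp⟩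
    refine tendsto_nhds_unique ((h1.comp h2).congr fun n => ?_) (hg x)
    simp only [Function.comp, smul_eq_mul, F, steklov]
    rw [intervalIntegral.integral_interval_sub_left (hf _ _) (hf _ _)]

/-! ### A local Morrey inequality -/

/-- The density of the Gagliardo seminorm of order `β + 1 / p`, that is
`|g x - g y| ^ p / |x - y| ^ (2 + β * p)`; it vanishes on the diagonal. -/
noncomputable def gagliardoDensity (p β : ℝ) (g : ℝ → ℝ) (z : ℝ × ℝ) : ℝ≥0∞ :=
  ‖g z.1 - g z.2‖ₑ ^ p * ENNReal.ofReal (|z.1 - z.2| ^ (-(2 + β * p)))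

lemma measurable_gagliardoDensity {p β : ℝ} {g : ℝ → ℝ} (hg : Continuous g) :
    Measurable (gagliardoDensity p β g) := by
  have h := hg.measurable
  unfold gagliardoDensity
  fun_prop

/-- Where `|x - y| ≤ ℓ`, the kernel of the energy is at least `ℓ ^ (-(2 + β p))`. -/
lemma lintegral_enorm_sub_rpow_le {p β ℓ : ℝ} (hp : 0 < p) (hβ : 0 ≤ β) {g : ℝ → ℝ} {S : Set (ℝ × ℝ)}
    (hS : MeasurableSet S) (hℓ : ∀ z ∈ S, |z.1 - z.2| ≤ ℓ) :
    ∫⁻ z in S, ‖g z.1 - g z.2‖ₑ ^ p ≤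
      ENNReal.ofReal (ℓ ^ (2 + β * p)) * ∫⁻ z in S, gagliardoDensity p β g z := by
  rw [← lintegral_const_mul' _ _ ENNReal.ofReal_ne_top]
  refine setLIntegral_mono' hS fun z hz => ?_
  rcases eq_or_ne z.1 z.2 with h | h
  · simp [h, hp]
  have hd : 0 < |z.1 - z.2| := abs_pos.2 (sub_ne_zero.2 h)
  have hγ : 0 ≤ 2 + β * p := by positivity
  rw [gagliardoDensity, mul_left_comm, ← ENNReal.ofReal_mul (Real.rpow_nonneg (hd.le.trans (hℓ z hz)) _)]
  refine le_mul_of_one_le_right zero_le (ENNReal.one_le_ofReal.2 ?_)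
  rw [Real.rpow_neg hd.le, ← div_eq_mul_inv, one_le_div (by positivity)]
  exact Real.rpow_le_rpow hd.le (hℓ z hz) hγ

/-- Comparison of the means over an interval and over its half; `s` may be negative. -/
lemma enorm_steklov_sub_half_le {p β s : ℝ} (hp : 1 < p) (hβ : 0 ≤ β) (hs : s ≠ 0) {g : ℝ → ℝ}
    (hg : Continuous g) (c : ℝ) :
    ‖steklov g s c - steklov g (s / 2) c‖ₑ ≤ ENNReal.ofReal (2 * |s| ^ β) *
      (∫⁻ z in uIoc c (c + s) ×ˢ uIoc c (c + s), gagliardoDensity p β g z) ^ (1 / p) := by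
  have hp0 : 0 < p := by linarith
  have hs0 : 0 < |s| := abs_pos.2 hs
  set J := uIoc c (c + s) with hJ
  have hJm : MeasurableSet J := measurableSet_uIoc
  set E := ∫⁻ z in J ×ˢ J, gagliardoDensity p β g z
  have hvol : volume J = ENNReal.ofReal |s| := by
    rw [hJ, uIoc, Real.volume_Ioc, max_sub_min_eq_abs]; simp
  have hsub : uIoc c (c + s / 2) ⊆ J := by
    apply uIoc_subset_uIoc_of_uIcc_subset_uIcc
    apply uIcc_subset_uIcc left_mem_uIcc
    rw [mem_uIcc]
    rcases hs.lt_or_gt with h | h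
    · right; constructor <;> linarith
    · left; constructor <;> linarith
  have hi : ∀ a b, IntervalIntegrable g volume a b := fun a b => hg.intervalIntegrable a b
  have hdouble : ∫ x in c..c + s, (∫ y in c..c + s / 2, (g x - g y)) =
      s ^ 2 / 2 * (steklov g s c - steklov g (s / 2) c) := by
    have h1 : ∀ x, ∫ y in c..c + s / 2, (g x - g y) =
        s / 2 * g x - ∫ y in c..c + s / 2, g y := fun x => by
      rw [intervalIntegral.integral_sub (by simp) (hi _ _)]
      simp
    simp only [h1]
    rw [intervalIntegral.integral_sub ((hi _ _).const_mul _) (by simp),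
      intervalIntegral.integral_const_mul, intervalIntegral.integral_const, steklov, steklov]
    simp only [add_sub_cancel_left, smul_eq_mul]
    field_simp
  have hcont : Continuous fun z : ℝ × ℝ => g z.1 - g z.2 := by fun_prop
  have h1 : ‖∫ x in c..c + s, (∫ y in c..c + s / 2, (g x - g y))‖ₑ ≤
      ∫⁻ z in J ×ˢ J, ‖g z.1 - g z.2‖ₑ := by
    have hn : ∀ (φ : ℝ → ℝ) (a b : ℝ), ‖∫ x in a..b, φ x‖ₑ ≤ ∫⁻ x in uIoc a b, ‖φ x‖ₑ := by
      intro φ a b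
      rw [← enorm_norm, intervalIntegral.norm_intervalIntegral_eq, enorm_norm]
      exact enorm_integral_le_lintegral_enorm _
    refine (hn _ _ _).trans ?_
    rw [Measure.volume_eq_prod, setLIntegral_prod _ (by fun_prop)]
    exact lintegral_mono fun x => (hn _ _ _).trans (lintegral_mono_set hsub)
  have h2 : ∫⁻ z in J ×ˢ J, ‖g z.1 - g z.2‖ₑ ≤
      (ENNReal.ofReal (|s| ^ (2 + β * p)) * E) ^ (1 / p) *
        (ENNReal.ofReal (|s| ^ 2)) ^ (1 - 1 / p) := by
    refine (lintegral_enorm_le_rpow_mul_measure hcont.aestronglyMeasurable hp.le).trans ?_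
    have hpp : 0 ≤ 1 - 1 / p := sub_nonneg.2 ((div_le_one hp0).2 hp.le)
    gcongr
    · refine lintegral_enorm_sub_rpow_le hp0 hβ (hJm.prod hJm) fun z hz => ?_
      have e1 := hz.1
      have e2 := hz.2
      rw [hJ, mem_uIoc] at e1 e2
      rw [abs_le]
      rcases hs.lt_or_gt with h | h
      · rw [abs_of_neg h]
        constructor <;> rcases e1 with e1 | e1 <;> rcases e2 with e2 | e2 <;> linarith
      · rw [abs_of_pos h]
        constructor <;> rcases e1 with e1 | e1 <;> rcases e2 with e2 | e2 <;> linarith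
    · rw [Measure.restrict_apply_univ, Measure.volume_eq_prod, Measure.prod_prod, hvol,
        ← ENNReal.ofReal_mul hs0.le, sq]
  -- The double integral of `g x - g y` is `s ^ 2 / 2` times the difference of the two means.
  rw [hdouble, enorm_mul] at h1
  have h3 := h1.trans h2
  have hpos : (0 : ℝ) < s ^ 2 / 2 := by positivity
  rw [Real.enorm_eq_ofReal hpos.le] at h3
  have h4 : (ENNReal.ofReal (|s| ^ (2 + β * p)) * E) ^ (1 / p) *
        (ENNReal.ofReal (|s| ^ 2)) ^ (1 - 1 / p) =
      ENNReal.ofReal (s ^ 2 / 2) * (ENNReal.ofReal (2 * |s| ^ β) * E ^ (1 / p)) := by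
    have e1 : (|s| ^ (2 + β * p)) ^ (1 / p) * (|s| ^ 2) ^ (1 - 1 / p) =
        s ^ 2 / 2 * (2 * |s| ^ β) := by
      rw [← sq_abs s, ← Real.rpow_natCast, ← Real.rpow_mul hs0.le, ← Real.rpow_mul hs0.le,
        ← Real.rpow_add hs0]
      have : (2 + β * p) * (1 / p) + ((2 : ℕ) : ℝ) * (1 - 1 / p) = ((2 : ℕ) : ℝ) + β := by
        push_cast; field_simp; ring
      rw [this, Real.rpow_add hs0]
      ring
    rw [ENNReal.mul_rpow_of_nonneg _ _ (by positivity), ENNReal.ofReal_rpow_of_pos (by positivity),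
      ENNReal.ofReal_rpow_of_pos (by positivity), mul_right_comm,
      ← ENNReal.ofReal_mul (by positivity), e1, ENNReal.ofReal_mul (by positivity), mul_assoc]
  rw [h4] at h3
  exact (ENNReal.mul_le_mul_iff_right (by simpa using hpos) ENNReal.ofReal_ne_top).1 h3

lemma tendsto_steklov_div_two_pow {g : ℝ → ℝ} (hg : Continuous g) {s : ℝ} (hs : s ≠ 0) (c : ℝ) :
    Tendsto (fun n : ℕ => steklov g (s / 2 ^ n) c) atTop (𝓝 (g c)) := by
  have h1 := hasDerivAt_iff_tendsto_slope_zero.1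
    (intervalIntegral.integral_hasDerivAt_right (hg.intervalIntegrable 0 c)
      (hg.stronglyMeasurableAtFilter _ _) hg.continuousAt)
  have h2 : Tendsto (fun n : ℕ => s / 2 ^ n) atTop (𝓝[≠] 0) := by
    refine tendsto_nhdsWithin_iff.2 ⟨?_, Eventually.of_forall fun n => by simp [hs]⟩
    have := (tendsto_pow_atTop_nhds_zero_of_lt_one (r := (1 / 2 : ℝ)) (by norm_num)
      (by norm_num)).const_mul s
    simpa [div_eq_mul_inv] using this
  refine (h1.comp h2).congr fun n => ?_
  simp only [Function.comp, smul_eq_mul, steklov]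
  rw [intervalIntegral.integral_interval_sub_left (hg.intervalIntegrable _ _)
    (hg.intervalIntegrable _ _)]

/-- A continuous function differs at an endpoint of an interval from its mean over the interval
by at most a multiple of its Gagliardo seminorm there. -/
lemma abs_steklov_sub_le {p β s : ℝ} (hp : 1 < p) (hβ : 0 < β) (hs : s ≠ 0) {g : ℝ → ℝ}
    (hg : Continuous g) (c : ℝ)
    (hE : ∫⁻ z in uIoc c (c + s) ×ˢ uIoc c (c + s), gagliardoDensity p β g z ≠ ⊤) :
    |steklov g s c - g c| ≤ 2 * |s| ^ β *
      ((∫⁻ z in uIoc c (c + s) ×ˢ uIoc c (c + s), gagliardoDensity p β g z) ^ (1 / p)).toReal /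
        (1 - (1 / 2) ^ β) := by
  have hp0 : 0 < p := by linarith
  set E := ∫⁻ z in uIoc c (c + s) ×ˢ uIoc c (c + s), gagliardoDensity p β g z
  have hq1 : (1 / 2 : ℝ) ^ β < 1 := Real.rpow_lt_one (by norm_num) (by norm_num) hβ
  have hEt : E ^ (1 / p) ≠ ⊤ := ENNReal.rpow_ne_top_of_nonneg (by positivity) hE
  have hstep : ∀ n : ℕ, dist (steklov g (s / 2 ^ n) c) (steklov g (s / 2 ^ (n + 1)) c) ≤
      2 * |s| ^ β * (E ^ (1 / p)).toReal * ((1 / 2) ^ β) ^ n := fun n => by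
    have hsn : s / 2 ^ n ≠ 0 := by positivity
    have h := enorm_steklov_sub_half_le hp hβ.le hsn hg c
    have hsub : uIoc c (c + s / 2 ^ n) ⊆ uIoc c (c + s) := by
      apply uIoc_subset_uIoc_of_uIcc_subset_uIcc
      apply uIcc_subset_uIcc left_mem_uIcc
      have h2 : (1 : ℝ) ≤ 2 ^ n := one_le_pow₀ (by norm_num)
      rw [mem_uIcc]
      rcases hs.lt_or_gt with h | h
      · right
        have : s ≤ s / 2 ^ n := by rw [le_div_iff₀ (by positivity)]; nlinarith
        have : s / 2 ^ n ≤ 0 := div_nonpos_of_nonpos_of_nonneg h.le (by positivity)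
        constructor <;> linarith
      · left
        have : s / 2 ^ n ≤ s := div_le_self h.le h2
        have : 0 ≤ s / 2 ^ n := by positivity
        constructor <;> linarith
    have h' := h.trans (mul_le_mul_right (ENNReal.rpow_le_rpow
      (lintegral_mono_set (prod_mono hsub hsub)) (by positivity : 0 ≤ 1 / p)) _)
    rw [← ENNReal.ofReal_toReal hEt, ← ENNReal.ofReal_mul (by positivity),
      Real.enorm_eq_ofReal_abs, ENNReal.ofReal_le_ofReal_iff (by positivity)] at h'
    rw [Real.dist_eq, pow_succ, ← div_div]
    refine h'.trans_eq ?_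
    rw [abs_div, abs_of_pos (by positivity : (0 : ℝ) < 2 ^ n),
      Real.div_rpow (abs_nonneg s) (by positivity), Real.div_rpow one_pos.le two_pos.le,
      Real.one_rpow, ← Real.rpow_natCast, ← Real.rpow_natCast, ← Real.rpow_mul two_pos.le,
      mul_comm (n : ℝ) β, Real.rpow_mul two_pos.le, Real.div_rpow one_pos.le (by positivity),
      Real.one_rpow]
    ring
  have := dist_le_of_le_geometric_of_tendsto₀ _ _ hq1 hstep (tendsto_steklov_div_two_pow hg hs c)
  simpa [Real.dist_eq] using this

/-- A one-dimensional Morrey inequality with a seminorm that only sees the interval itself. -/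
lemma ofReal_abs_sub_le_gagliardo {p β a b : ℝ} (hp : 1 < p) (hβ : 0 < β) (hab : a < b) {g : ℝ → ℝ}
    (hg : Continuous g) :
    ENNReal.ofReal |g b - g a| ≤ ENNReal.ofReal (4 / (1 - (1 / 2) ^ β)) *
      ENNReal.ofReal ((b - a) ^ β) *
        (∫⁻ z in Ioc a b ×ˢ Ioc a b, gagliardoDensity p β g z) ^ (1 / p) := by
  have hp0 : 0 < p := by linarith
  have hq1 : 0 < 1 - (1 / 2 : ℝ) ^ β :=
    sub_pos.2 (Real.rpow_lt_one (by norm_num) (by norm_num) hβ)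
  have hba : 0 < b - a := sub_pos.2 hab
  set E := ∫⁻ z in Ioc a b ×ˢ Ioc a b, gagliardoDensity p β g z with hEdef
  by_cases hE : E = ⊤
  · rw [hE, ENNReal.top_rpow_of_pos (by positivity), ENNReal.mul_top]
    · exact le_top
    · rw [← ENNReal.ofReal_mul (by positivity)]
      simp only [ne_eq, ENNReal.ofReal_eq_zero, not_le]
      positivity
  have hEt : E ^ (1 / p) ≠ ⊤ := ENNReal.rpow_ne_top_of_nonneg (by positivity) hE
  have ha := abs_steklov_sub_le (p := p) (s := b - a) hp hβ hba.ne' hg a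
  have hb := abs_steklov_sub_le (p := p) (s := a - b) hp hβ (by linarith) hg b
  rw [add_sub_cancel, uIoc_of_le hab.le, ← hEdef, abs_of_pos hba] at ha
  rw [add_sub_cancel, uIoc_comm, uIoc_of_le hab.le, ← hEdef, abs_sub_comm a b,
    abs_of_pos hba] at hb
  -- Both endpoints are compared with the same number, the mean of `g` over `[a, b]`.
  have hm : steklov g (a - b) b = steklov g (b - a) a := by
    rw [steklov, steklov, add_sub_cancel, add_sub_cancel, intervalIntegral.integral_symm a b,
      ← neg_sub b a, inv_neg, neg_mul_neg]
  rw [hm] at hb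
  rw [← ENNReal.ofReal_toReal hEt, ← ENNReal.ofReal_mul (by positivity),
    ← ENNReal.ofReal_mul (by positivity)]
  apply ENNReal.ofReal_le_ofReal
  calc |g b - g a| ≤ |steklov g (b - a) a - g a| + |steklov g (b - a) a - g b| := by
        rw [abs_sub_comm (steklov g (b - a) a) (g b), add_comm]
        exact abs_sub_le _ _ _
    _ ≤ _ := add_le_add (ha hE) (hb hE)
    _ = _ := by ring

/-! ### Gagliardo energy near the diagonal -/

/-- A bound for the shifts in `(0, 1]` extends by periodicity to negative shifts and to any
period. -/
lemma lintegral_shift_le {g : ℝ → ℝ} (hper : Function.Periodic g 1) {p α : ℝ} {M : ℝ≥0}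
    (hM : ∀ h ∈ Ioc (0 : ℝ) 1, ∫⁻ x in Ioc (0 : ℝ) 1, ‖g (x + h) - g x‖ₑ ^ p ≤
      (M * ENNReal.ofReal (h ^ α)) ^ p) {s : ℝ} (hs : s ≠ 0) (hs1 : |s| ≤ 1) (t : ℝ) :
    ∫⁻ x in Ioc t (t + 1), ‖g (x + s) - g x‖ₑ ^ p ≤ (M * ENNReal.ofReal (|s| ^ α)) ^ p := by
  have hpos : ∀ h ∈ Ioc (0 : ℝ) 1, ∀ t, ∫⁻ x in Ioc t (t + 1), ‖g (x + h) - g x‖ₑ ^ p ≤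
      (M * ENNReal.ofReal (h ^ α)) ^ p := fun h hh t => by
    have hp1 : Function.Periodic (fun u => ‖g (u + h) - g u‖ₑ ^ p) 1 := fun u => by
      simp only
      rw [add_right_comm, hper, hper]
    rw [setLIntegral_Ioc_eq_of_periodic hp1 t 0]
    simpa using hM h hh
  rcases hs.lt_or_gt with h | h
  · rw [abs_of_neg h] at hs1 ⊢
    have h1 := (measurePreserving_add_right volume s).setLIntegral_comp_preimage_emb
      (MeasurableEquiv.addRight s).measurableEmbedding
      (fun u => ‖g (u + -s) - g u‖ₑ ^ p) (Ioc (t + s) (t + s + 1))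
    have h2 : (fun x => x + s) ⁻¹' Ioc (t + s) (t + s + 1) = Ioc t (t + 1) := by
      rw [preimage_add_const_Ioc]; ring_nf
    rw [h2] at h1
    simp only [add_neg_cancel_right] at h1
    calc _ = ∫⁻ x in Ioc t (t + 1), ‖g x - g (x + s)‖ₑ ^ p := by
          simp only [← edist_eq_enorm_sub, edist_comm]
      _ ≤ _ := by rw [h1]; exact hpos _ ⟨by linarith, hs1⟩ _
  · rw [abs_of_pos h] at hs1 ⊢
    exact hpos s ⟨h, hs1⟩ t

lemma lintegral_Icc_abs_rpow {h γ : ℝ} (hh : 0 ≤ h) (hγ : 0 < γ) :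
    ∫⁻ s in Icc (-h) h, ENNReal.ofReal (|s| ^ (γ - 1)) ≤ ENNReal.ofReal (2 * (h ^ γ / γ)) := by
  have h1 : ∫⁻ s in Icc 0 h, ENNReal.ofReal (|s| ^ (γ - 1)) = ENNReal.ofReal (h ^ γ / γ) := by
    have hi : IntervalIntegrable (fun s : ℝ => s ^ (γ - 1)) volume 0 h :=
      intervalIntegral.intervalIntegrable_rpow' (by linarith)
    have h2 : ∫ s in (0 : ℝ)..h, s ^ (γ - 1) = h ^ γ / γ := by
      rw [integral_rpow (Or.inl (by linarith))]
      simp [hγ.ne']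
    rw [← h2, intervalIntegral.integral_of_le hh, ofReal_integral_eq_lintegral_ofReal
      ((intervalIntegrable_iff_integrableOn_Ioc_of_le hh).1 hi)
      ((ae_restrict_iff' measurableSet_Ioc).2 (Eventually.of_forall fun s hs =>
        Real.rpow_nonneg hs.1.le _)), restrict_Ioc_eq_restrict_Icc]
    exact setLIntegral_congr_fun measurableSet_Icc fun s hs => by simp only [abs_of_nonneg hs.1]
  have h3 : ∫⁻ s in Icc (-h) 0, ENNReal.ofReal (|s| ^ (γ - 1)) = ENNReal.ofReal (h ^ γ / γ) := by
    rw [← h1]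
    have := (Measure.measurePreserving_neg (volume : Measure ℝ)).setLIntegral_comp_preimage_emb
      (MeasurableEquiv.neg ℝ).measurableEmbedding
      (fun s => ENNReal.ofReal (|s| ^ (γ - 1))) (Icc 0 h)
    simpa using this
  rw [← Icc_union_Icc_eq_Icc (neg_nonpos.2 hh) hh, two_mul,
    ENNReal.ofReal_add (by positivity) (by positivity)]
  exact (lintegral_union_le _ _ _).trans (by rw [h1, h3])

/-- The Gagliardo energy in a strip of width `h` around the diagonal. In the coordinates
`(x, s) = (x, y - x)` the integral over `x` is controlled by the modulus of continuity at `|s|`. -/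
lemma lintegral_strip_gagliardo_le {g : ℝ → ℝ} (hg : Continuous g) (hper : Function.Periodic g 1)
    {p α β : ℝ} (hp : 1 < p) (hβ : β < α - 1 / p) {M : ℝ≥0}
    (hM : ∀ h ∈ Ioc (0 : ℝ) 1, ∫⁻ x in Ioc (0 : ℝ) 1, ‖g (x + h) - g x‖ₑ ^ p ≤
      (M * ENNReal.ofReal (h ^ α)) ^ p) {h : ℝ} (hh0 : 0 ≤ h) (hh : h ≤ 1) (t : ℝ) :
    ∫⁻ z in {z : ℝ × ℝ | z.1 ∈ Ioc t (t + 1) ∧ |z.2 - z.1| ≤ h}, gagliardoDensity p β g z ≤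
      (M : ℝ≥0∞) ^ p * ENNReal.ofReal (2 * (h ^ ((α - 1 / p - β) * p) /
        ((α - 1 / p - β) * p))) := by
  have hp0 : 0 < p := by linarith
  set γ := (α - 1 / p - β) * p with hγ
  have hγ0 : 0 < γ := mul_pos (by linarith) hp0
  set T := {z : ℝ × ℝ | z.1 ∈ Ioc t (t + 1) ∧ |z.2 - z.1| ≤ h}
  have hT : MeasurableSet T := by
    refine (measurable_fst measurableSet_Ioc).inter ?_
    exact (isClosed_le (by fun_prop) continuous_const : IsClosed
      {z : ℝ × ℝ | |z.2 - z.1| ≤ h}).measurableSet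
  have hK : Measurable (T.indicator (gagliardoDensity p β g)) :=
    (measurable_gagliardoDensity hg).indicator hT
  rw [← lintegral_indicator hT, Measure.volume_eq_prod, lintegral_prod _ hK.aemeasurable]
  have h1 : ∀ x : ℝ, ∫⁻ y, T.indicator (gagliardoDensity p β g) (x, y) =
      ∫⁻ s, T.indicator (gagliardoDensity p β g) (x, x + s) := fun x =>
    (lintegral_add_left_eq_self (fun y => T.indicator (gagliardoDensity p β g) (x, y)) x).symm
  simp only [h1]
  rw [lintegral_lintegral_swap (by
    exact (hK.comp (by fun_prop : Measurable fun z : ℝ × ℝ => (z.1, z.1 + z.2))).aemeasurable)]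
  calc _ ≤ ∫⁻ s, (Icc (-h) h).indicator
        (fun s => (M : ℝ≥0∞) ^ p * ENNReal.ofReal (|s| ^ (γ - 1))) s := ?_
    _ ≤ _ := by
        rw [lintegral_indicator measurableSet_Icc, lintegral_const_mul _ (by fun_prop)]
        gcongr
        exact lintegral_Icc_abs_rpow hh0 hγ0
  refine lintegral_mono fun s => ?_
  by_cases hs : s ∈ Icc (-h) h
  swap
  · rw [indicator_of_notMem hs, nonpos_iff_eq_zero]
    refine lintegral_eq_zero_of_ae_eq_zero (Eventually.of_forall fun x => ?_)
    refine indicator_of_notMem (fun hx => hs ?_) _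
    simpa [abs_le] using hx.2
  rw [indicator_of_mem hs]
  have hsh : |s| ≤ h := abs_le.2 hs
  rcases eq_or_ne s 0 with rfl | hs0
  · refine le_of_eq_of_le (lintegral_eq_zero_of_ae_eq_zero (Eventually.of_forall fun x => ?_))
      zero_le
    simp [indicator, gagliardoDensity, hp0]
  have habs : 0 < |s| := abs_pos.2 hs0
  calc ∫⁻ x, T.indicator (gagliardoDensity p β g) (x, x + s)
      ≤ ∫⁻ x, (Ioc t (t + 1)).indicator
        (fun x => ‖g (x + s) - g x‖ₑ ^ p * ENNReal.ofReal (|s| ^ (-(2 + β * p)))) x := by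
        refine lintegral_mono fun x => ?_
        by_cases hx : (x, x + s) ∈ T
        · rw [indicator_of_mem hx, indicator_of_mem hx.1, gagliardoDensity]
          simp only [← edist_eq_enorm_sub, edist_comm (g x), sub_add_cancel_left, abs_neg]
          exact le_rfl
        · rw [indicator_of_notMem hx]
          exact zero_le
    _ ≤ (M * ENNReal.ofReal (|s| ^ α)) ^ p * ENNReal.ofReal (|s| ^ (-(2 + β * p))) := by
        rw [lintegral_indicator measurableSet_Ioc, lintegral_mul_const' _ _ ENNReal.ofReal_ne_top]
        gcongr
        exact lintegral_shift_le hper hM hs0 (hsh.trans hh) t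
    _ = _ := by
        rw [ENNReal.mul_rpow_of_nonneg _ _ hp0.le, ENNReal.ofReal_rpow_of_pos (by positivity),
          mul_assoc, ← ENNReal.ofReal_mul (by positivity), ← Real.rpow_mul habs.le,
          ← Real.rpow_add habs]
        congr 3
        rw [hγ]
        field_simp
        ring

/-- Increments of `g` over disjoint intervals of length at most `h`: the Gagliardo energies of the
intervals add up to at most the energy of the strip of width `h`. -/
lemma sum_abs_sub_rpow_le {g : ℝ → ℝ} (hg : Continuous g) (hper : Function.Periodic g 1)
    {p α β : ℝ} (hp : 1 < p) (hβ0 : 0 < β) (hβ : β < α - 1 / p) {M : ℝ≥0}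
    (hM : ∀ h ∈ Ioc (0 : ℝ) 1, ∫⁻ x in Ioc (0 : ℝ) 1, ‖g (x + h) - g x‖ₑ ^ p ≤
      (M * ENNReal.ofReal (h ^ α)) ^ p) {h : ℝ} (hh0 : 0 < h) (hh : h ≤ 1) {t : ℝ}
    {ι : Type*} (S : Finset ι) {a b : ι → ℝ} (hab : ∀ i ∈ S, a i < b i)
    (hlen : ∀ i ∈ S, b i - a i ≤ h) (hsub : ∀ i ∈ S, Ioc (a i) (b i) ⊆ Ioc t (t + 1))
    (hdisj : (S : Set ι).PairwiseDisjoint fun i => Ioc (a i) (b i)) :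
    ∑ i ∈ S, ENNReal.ofReal |g (b i) - g (a i)| ^ p ≤
      (ENNReal.ofReal ((4 / (1 - (1 / 2) ^ β)) * (2 / ((α - 1 / p - β) * p)) ^ (1 / p)) * M *
        ENNReal.ofReal (h ^ (α - 1 / p))) ^ p := by
  have hp0 : 0 < p := by linarith
  have hq1 : 0 < 1 - (1 / 2 : ℝ) ^ β :=
    sub_pos.2 (Real.rpow_lt_one (by norm_num) (by norm_num) hβ0)
  have hγ0 : 0 < (α - 1 / p - β) * p := mul_pos (by linarith) hp0
  set A := 4 / (1 - (1 / 2 : ℝ) ^ β) with hA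
  have hA0 : 0 < A := by positivity
  calc ∑ i ∈ S, ENNReal.ofReal |g (b i) - g (a i)| ^ p
      ≤ ∑ i ∈ S, ENNReal.ofReal (A * h ^ β) ^ p *
          ∫⁻ z in Ioc (a i) (b i) ×ˢ Ioc (a i) (b i), gagliardoDensity p β g z := by
        refine Finset.sum_le_sum fun i hi => ?_
        have h1 := ofReal_abs_sub_le_gagliardo hp hβ0 (hab i hi) hg
        rw [← ENNReal.ofReal_mul hA0.le] at h1
        have h2 := ENNReal.rpow_le_rpow h1 hp0.le
        rw [ENNReal.mul_rpow_of_nonneg _ _ hp0.le, ← ENNReal.rpow_mul,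
          one_div_mul_cancel hp0.ne', ENNReal.rpow_one] at h2
        refine h2.trans ?_
        gcongr
        · exact sub_nonneg.2 (hab i hi).le
        · exact hlen i hi
    _ = ENNReal.ofReal (A * h ^ β) ^ p * ∫⁻ z in ⋃ i ∈ S, Ioc (a i) (b i) ×ˢ Ioc (a i) (b i),
          gagliardoDensity p β g z := by
        rw [← Finset.mul_sum, lintegral_biUnion_finset]
        · exact fun i hi j hj hij => (Set.disjoint_prod.2 (Or.inl (hdisj hi hj hij)))
        · exact fun i _ => measurableSet_Ioc.prod measurableSet_Ioc
    _ ≤ ENNReal.ofReal (A * h ^ β) ^ p * ((M : ℝ≥0∞) ^ p *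
          ENNReal.ofReal (2 * (h ^ ((α - 1 / p - β) * p) / ((α - 1 / p - β) * p)))) := by
        gcongr
        refine (lintegral_mono_set ?_).trans
          (lintegral_strip_gagliardo_le hg hper hp hβ hM hh0.le hh t)
        refine iUnion₂_subset fun i hi z hz => ⟨hsub i hi hz.1, abs_le.2 ?_⟩
        have := hlen i hi
        constructor <;> linarith [hz.1.1, hz.1.2, hz.2.1, hz.2.2]
    _ = _ := by
        rw [mul_right_comm, ← ENNReal.ofReal_mul (by positivity),
          ENNReal.mul_rpow_of_nonneg _ _ hp0.le, ENNReal.ofReal_rpow_of_pos (by positivity),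
          ENNReal.ofReal_rpow_of_pos (by positivity), mul_left_comm, mul_comm _ ((M : ℝ≥0∞) ^ p),
          ← ENNReal.ofReal_mul (by positivity)]
        congr 2
        have e : h ^ ((α - 1 / p - β) * p) = (h ^ (α - 1 / p - β)) ^ p := Real.rpow_mul hh0.le _ _
        have e2 : 2 * (h ^ ((α - 1 / p - β) * p) / ((α - 1 / p - β) * p)) =
            ((2 / ((α - 1 / p - β) * p)) ^ (1 / p) * h ^ (α - 1 / p - β)) ^ p := by
          rw [Real.mul_rpow (by positivity) (by positivity), ← Real.rpow_mul (by positivity),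
            one_div_mul_cancel hp0.ne', Real.rpow_one, e]
          ring
        rw [e2, ← Real.mul_rpow (by positivity) (by positivity)]
        congr 1
        have e3 : h ^ (α - 1 / p) = h ^ β * h ^ (α - 1 / p - β) := by
          rw [← Real.rpow_add hh0]; ring_nf
        rw [e3]
        ring

/-! ### Weighted sums over dyadic levels -/

lemma sum_le_sum_range_card {v : ℕ → ℝ≥0∞} (hv : Antitone v) (s : Finset ℕ) :
    ∑ k ∈ s, v k ≤ ∑ k ∈ Finset.range s.card, v k := by
  induction s using Finset.induction_on_max with
  | empty => simp
  | insert a s ha ih =>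
    have hmem : a ∉ s := fun h => lt_irrefl _ (ha a h)
    have hcard : s.card ≤ a := by
      have := Finset.card_le_card (fun x hx => Finset.mem_range.2 (ha x hx) : s ⊆ Finset.range a)
      simpa using this
    rw [Finset.sum_insert hmem, Finset.card_insert_of_notMem hmem, Finset.sum_range_succ, add_comm]
    exact add_le_add ih (hv hcard)

/-- An initial segment of length `N` is covered by the dyadic blocks starting at or below `N`, and
`y ↦ y ^ q` is subadditive. -/
lemma sum_range_rpow_le_sum_dyadic (u : ℕ → ℝ≥0∞) {q : ℝ} (hq0 : 0 < q) (hq1 : q ≤ 1) {N Q : ℕ}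
    (hNQ : N ≤ Q) :
    (∑ i ∈ Finset.range N, u (i + 1)) ^ q ≤
      ∑ n ∈ Finset.range Q with 2 ^ n ≤ N, (∑ k ∈ Finset.Icc (2 ^ n) (2 ^ (n + 1)), u k) ^ q := by
  refine le_trans (ENNReal.rpow_le_rpow ?_ hq0.le) (Finset.le_sum_of_subadditive
    (fun y : ℝ≥0∞ => y ^ q) (ENNReal.zero_rpow_of_pos hq0).le
    (fun x y => ENNReal.rpow_add_le_add_rpow x y hq0.le hq1) _ _)
  have hmaps : ∀ i ∈ Finset.range N, Nat.log 2 (i + 1) ∈ {n ∈ Finset.range Q | 2 ^ n ≤ N} := by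
    intro i hi
    have hi' := Finset.mem_range.1 hi
    have h1 : 2 ^ Nat.log 2 (i + 1) ≤ i + 1 := Nat.pow_log_le_self 2 (by omega)
    have h2 : Nat.log 2 (i + 1) < 2 ^ Nat.log 2 (i + 1) := Nat.lt_two_pow_self
    simp only [Finset.mem_filter, Finset.mem_range]
    omega
  rw [← Finset.sum_fiberwise_of_maps_to hmaps]
  refine Finset.sum_le_sum fun n _ => ?_
  have h := Finset.sum_map {i ∈ Finset.range N | Nat.log 2 (i + 1) = n} (addRightEmbedding 1) u
  simp only [addRightEmbedding_apply] at h
  rw [← h]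
  refine Finset.sum_le_sum_of_subset fun k hk => ?_
  obtain ⟨i, hi, rfl⟩ := Finset.mem_map.1 hk
  obtain ⟨-, rfl⟩ := Finset.mem_filter.1 hi
  exact Finset.mem_Icc.2 ⟨Nat.pow_log_le_self 2 (Nat.succ_ne_zero i),
    (Nat.lt_pow_succ_log_self (by norm_num) _).le⟩

lemma sum_two_pow_le (N Q : ℕ) :
    ∑ n ∈ Finset.range Q with 2 ^ n ≤ N, (2 : ℝ≥0∞) ^ n ≤ 2 * N := by
  rcases Nat.eq_zero_or_pos N with rfl | hN
  · simp
  have h1 : {n ∈ Finset.range Q | 2 ^ n ≤ N} ⊆ Finset.range (Nat.log 2 N + 1) := fun n hn => by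
    rw [Finset.mem_range, Nat.lt_succ_iff]
    exact Nat.le_log_of_pow_le (by norm_num) (Finset.mem_filter.1 hn).2
  have h2 : ∑ n ∈ Finset.range (Nat.log 2 N + 1), 2 ^ n ≤ 2 * N := by
    have h3 := Nat.geomSum_lt (m := 2) (n := Nat.log 2 N + 1)
      (s := Finset.range (Nat.log 2 N + 1)) le_rfl (fun k hk => Finset.mem_range.1 hk)
    have h4 : 2 ^ Nat.log 2 N ≤ N := Nat.pow_log_le_self 2 hN.ne'
    rw [pow_succ] at h3
    omega
  refine (Finset.sum_le_sum_of_subset h1).trans ?_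
  exact_mod_cast h2

/-- Up to a constant, both sides are governed by the least element of `J`. -/
lemma sum_geometric_rpow_le {θ : ℝ} (hθ : 0 < θ) (J : Finset ℕ) :
    ∑ j ∈ J, ((2⁻¹ : ℝ≥0∞) ^ j) ^ θ ≤ (1 - (2⁻¹ : ℝ≥0∞) ^ θ)⁻¹ * (∑ j ∈ J, (2⁻¹ : ℝ≥0∞) ^ j) ^ θ := by
  rcases J.eq_empty_or_nonempty with rfl | hJ
  · simp
  set m := J.min' hJ with hm
  have hle : ∀ j ∈ J, m ≤ j := fun j hj => J.min'_le j hj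
  have hr : ∀ j : ℕ, ((2⁻¹ : ℝ≥0∞) ^ j) ^ θ = ((2⁻¹ : ℝ≥0∞) ^ θ) ^ j := fun j => by
    rw [← ENNReal.rpow_natCast, ← ENNReal.rpow_natCast, ← ENNReal.rpow_mul, ← ENNReal.rpow_mul,
      mul_comm]
  calc ∑ j ∈ J, ((2⁻¹ : ℝ≥0∞) ^ j) ^ θ
      = ((2⁻¹ : ℝ≥0∞) ^ θ) ^ m * ∑ j ∈ J, ((2⁻¹ : ℝ≥0∞) ^ θ) ^ (j - m) := by
        rw [Finset.mul_sum]
        refine Finset.sum_congr rfl fun j hj => ?_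
        rw [hr, ← pow_add, Nat.add_sub_cancel' (hle j hj)]
    _ ≤ ((2⁻¹ : ℝ≥0∞) ^ θ) ^ m * (1 - (2⁻¹ : ℝ≥0∞) ^ θ)⁻¹ := by
        gcongr
        have hinj : Set.InjOn (fun j => j - m) (J : Set ℕ) := fun i hi j hj hij => by
          have h1 := hle i hi
          have h2 := hle j hj
          simp only at hij
          omega
        rw [← Finset.sum_image (f := fun i => ((2⁻¹ : ℝ≥0∞) ^ θ) ^ i) hinj,
          ← ENNReal.tsum_geometric]
        exact ENNReal.sum_le_tsum _
    _ ≤ _ := by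
        rw [mul_comm, ← hr]
        gcongr
        exact Finset.single_le_sum (f := fun j => (2⁻¹ : ℝ≥0∞) ^ j) (fun _ _ => zero_le)
          (J.min'_mem hJ)

/-- The discrete core. The terms `x k` are sorted into levels `κ k`; on level `j` their `ℓ^p` norm
is at most `D * 2 ^ (-j θ)`, and the numbers `2 ^ (-κ k)` have a bounded sum, so that level `j`
holds `O(2 ^ j)` terms. On each level the weights are at worst an initial segment of `w`,
cut into dyadic blocks. -/
lemma sum_mul_le_of_levels {p p' r' θ : ℝ} (hp : p.HolderConjugate p')
    (hr : r'.HolderConjugate (1 / θ)) {w x : ℕ → ℝ≥0∞} (hw : Antitone fun k => w (k + 1))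
    (S : Finset ℕ) (κ : ℕ → ℕ) {D : ℝ≥0∞}
    (hD : ∀ j, ∑ k ∈ S with κ k = j, x k ^ p ≤ (D * ((2⁻¹ : ℝ≥0∞) ^ j) ^ θ) ^ p)
    (hκ : ∑ k ∈ S, (2⁻¹ : ℝ≥0∞) ^ κ k ≤ 2) :
    ∑ k ∈ S, x k * w (k + 1) ≤ D * (1 - (2⁻¹ : ℝ≥0∞) ^ θ)⁻¹ * 4 ^ θ *
      (∑' n : ℕ, (((2⁻¹ : ℝ≥0∞) ^ n) ^ θ *
        (∑ k ∈ Finset.Icc (2 ^ n) (2 ^ (n + 1)), w k ^ p') ^ (1 / p')) ^ r') ^ (1 / r') := by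
  have hθ : 0 < θ := one_div_pos.1 hr.symm.pos
  have hp'0 : 0 < p' := hp.symm.pos
  set b : ℝ≥0∞ := 2⁻¹ with hb
  set C := (1 - b ^ θ)⁻¹
  set L : ℕ → ℝ≥0∞ := fun n => (∑ k ∈ Finset.Icc (2 ^ n) (2 ^ (n + 1)), w k ^ p') ^ (1 / p')
  set N : ℕ → ℕ := fun j => (S.filter (κ · = j)).card with hN
  set J := S.image κ
  set Q := S.card
  have hmaps : ∀ k ∈ S, κ k ∈ J := fun k hk => Finset.mem_image_of_mem κ hk
  have hNQ : ∀ j, N j ≤ Q := fun j => Finset.card_le_card (Finset.filter_subset _ _)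
  have hlevel : ∀ j, ∑ k ∈ S with κ k = j, x k * w (k + 1) ≤
      ∑ n ∈ Finset.range Q with 2 ^ n ≤ N j, D * L n * (b ^ j) ^ θ := fun j => by
    calc _ ≤ (∑ k ∈ S with κ k = j, x k ^ p) ^ (1 / p) *
          (∑ k ∈ S with κ k = j, w (k + 1) ^ p') ^ (1 / p') :=
          ENNReal.inner_le_Lp_mul_Lq _ _ _ hp
      _ ≤ ((D * (b ^ j) ^ θ) ^ p) ^ (1 / p) *
          (∑ i ∈ Finset.range (N j), w (i + 1) ^ p') ^ (1 / p') := by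
          have h1 : Antitone fun k => w (k + 1) ^ p' := fun i k hik =>
            ENNReal.rpow_le_rpow (hw hik) hp'0.le
          have := hp.pos
          have h2 : ∑ k ∈ S with κ k = j, w (k + 1) ^ p' ≤
              ∑ i ∈ Finset.range (N j), w (i + 1) ^ p' := sum_le_sum_range_card h1 _
          exact mul_le_mul' (ENNReal.rpow_le_rpow (hD j) (by positivity))
            (ENNReal.rpow_le_rpow h2 (by positivity))
      _ ≤ D * (b ^ j) ^ θ * ∑ n ∈ Finset.range Q with 2 ^ n ≤ N j, L n := by
          rw [← ENNReal.rpow_mul, mul_one_div_cancel hp.pos.ne', ENNReal.rpow_one]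
          gcongr
          exact sum_range_rpow_le_sum_dyadic (fun k => w k ^ p') (by positivity)
            ((div_le_one hp'0).2 hp.symm.lt.le) (hNQ j)
      _ = _ := by
          rw [Finset.mul_sum]
          exact Finset.sum_congr rfl fun n _ => mul_right_comm _ _ _
  have hmass : ∑ n ∈ Finset.range Q, 2 ^ n * ∑ j ∈ J with 2 ^ n ≤ N j, b ^ j ≤ 4 := by
    calc ∑ n ∈ Finset.range Q, 2 ^ n * ∑ j ∈ J with 2 ^ n ≤ N j, b ^ j
        = ∑ j ∈ J, b ^ j * ∑ n ∈ Finset.range Q with 2 ^ n ≤ N j, 2 ^ n := by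
          simp only [Finset.mul_sum, Finset.sum_filter, mul_ite, mul_zero]
          rw [Finset.sum_comm]
          simp only [mul_comm]
      _ ≤ ∑ j ∈ J, b ^ j * (2 * N j) := by
          gcongr
          exact sum_two_pow_le _ _
      _ = 2 * ∑ k ∈ S, b ^ κ k := by
          rw [← Finset.sum_fiberwise_of_maps_to hmaps, Finset.mul_sum]
          refine Finset.sum_congr rfl fun j _ => ?_
          rw [Finset.sum_congr rfl (g := fun _ => b ^ j)
            fun k hk => by rw [(Finset.mem_filter.1 hk).2]]
          rw [Finset.sum_const, nsmul_eq_mul, mul_left_comm, mul_comm (b ^ j)]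
      _ ≤ 2 * 2 := by gcongr
      _ = 4 := by norm_num
  calc ∑ k ∈ S, x k * w (k + 1)
      = ∑ j ∈ J, ∑ k ∈ S with κ k = j, x k * w (k + 1) :=
        (Finset.sum_fiberwise_of_maps_to hmaps _).symm
    _ ≤ ∑ j ∈ J, ∑ n ∈ Finset.range Q with 2 ^ n ≤ N j, D * L n * (b ^ j) ^ θ :=
        Finset.sum_le_sum fun j _ => hlevel j
    _ = ∑ n ∈ Finset.range Q, D * L n * ∑ j ∈ J with 2 ^ n ≤ N j, (b ^ j) ^ θ := by
        simp only [Finset.mul_sum, Finset.sum_filter, mul_ite, mul_zero]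
        rw [Finset.sum_comm]
    _ ≤ ∑ n ∈ Finset.range Q, D * L n * (C * (∑ j ∈ J with 2 ^ n ≤ N j, b ^ j) ^ θ) := by
        gcongr
        exact sum_geometric_rpow_le hθ _
    _ = D * C * ∑ n ∈ Finset.range Q, ((b ^ n) ^ θ * L n) *
          (2 ^ n * ∑ j ∈ J with 2 ^ n ≤ N j, b ^ j) ^ θ := by
        rw [Finset.mul_sum]
        refine Finset.sum_congr rfl fun n _ => ?_
        have h1 : (b ^ n) ^ θ * ((2 : ℝ≥0∞) ^ n) ^ θ = 1 := by
          rw [← ENNReal.mul_rpow_of_nonneg _ _ hθ.le, ← mul_pow, hb,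
            ENNReal.inv_mul_cancel two_ne_zero ENNReal.ofNat_ne_top, one_pow, ENNReal.one_rpow]
        rw [ENNReal.mul_rpow_of_nonneg _ _ hθ.le]
        calc _ = D * L n * (C * (∑ j ∈ J with 2 ^ n ≤ N j, b ^ j) ^ θ) *
              ((b ^ n) ^ θ * ((2 : ℝ≥0∞) ^ n) ^ θ) := by rw [h1, mul_one]
          _ = _ := by ring
    _ ≤ D * C * ((∑ n ∈ Finset.range Q, ((b ^ n) ^ θ * L n) ^ r') ^ (1 / r') *
          (∑ n ∈ Finset.range Q, ((2 ^ n * ∑ j ∈ J with 2 ^ n ≤ N j, b ^ j) ^ θ) ^ (1 / θ)) ^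
            (1 / (1 / θ))) := by
        gcongr
        exact ENNReal.inner_le_Lp_mul_Lq _ _ _ hr
    _ ≤ D * C * ((∑' n, ((b ^ n) ^ θ * L n) ^ r') ^ (1 / r') * 4 ^ θ) := by
        simp only [← ENNReal.rpow_mul, mul_one_div_cancel hθ.ne', ENNReal.rpow_one, one_div_one_div]
        have := hr.pos
        gcongr
        exact ENNReal.sum_le_tsum _
    _ = _ := by ring

/-! ### The `Λ`-variation -/

lemma MemLip.lipNorm_ne_top {α p : ℝ} {f : ℝ → ℝ} (hf : MemLip α p f) : lipNorm α p f ≠ ⊤ := by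
  obtain ⟨C, hC⟩ := hf.modulus_le
  refine ne_top_of_le_ne_top (ENNReal.coe_ne_top (r := C)) (iSup₂_le fun δ hδ => ?_)
  exact ENNReal.div_le_of_le_mul (hC δ ⟨hδ.1.le, hδ.2⟩)

lemma MemLip.lintegral_shift_le_lipNorm {α p : ℝ} (hp : 1 < p) {f : ℝ → ℝ} (hf : MemLip α p f)
    {h : ℝ} (hh : h ∈ Ioc (0 : ℝ) 1) :
    ∫⁻ x in Ioc (0 : ℝ) 1, ‖f (x + h) - f x‖ₑ ^ p ≤
      ((lipNorm α p f).toNNReal * ENNReal.ofReal (h ^ α)) ^ p := by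
  have hp0 : 0 < p := by linarith
  have h0 : ENNReal.ofReal (h ^ α) ≠ 0 := by simpa using Real.rpow_pos_of_pos hh.1 α
  have h1 : eLpNorm (fun x => f (x + h) - f x) (ENNReal.ofReal p)
      (volume.restrict (Ioc (0 : ℝ) 1)) ≤ modulus p f h :=
    le_iSup₂_of_le h ⟨hh.1.le, le_rfl⟩ le_rfl
  have h2 : modulus p f h / ENNReal.ofReal (h ^ α) ≤ lipNorm α p f := le_iSup₂_of_le h hh le_rfl
  rw [ENNReal.div_le_iff h0 ENNReal.ofReal_ne_top] at h2
  have h3 := h1.trans h2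
  rw [eLpNorm_eq_lintegral_rpow_enorm_toReal (by simpa using hp0) ENNReal.ofReal_ne_top,
    ENNReal.toReal_ofReal hp0.le] at h3
  have h4 := ENNReal.rpow_le_rpow h3 hp0.le
  rwa [← ENNReal.rpow_mul, one_div_mul_cancel hp0.ne', ENNReal.rpow_one,
    ← ENNReal.coe_toNNReal hf.lipNorm_ne_top] at h4

lemma MemLip.intervalIntegrable {α p : ℝ} (hp : 1 < p) {f : ℝ → ℝ} (hf : MemLip α p f) (a b : ℝ) :
    IntervalIntegrable f volume a b := by
  refine hf.periodic.intervalIntegrable₀ one_ne_zero ?_ a b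
  rw [intervalIntegrable_iff_integrableOn_Ioc_of_le zero_le_one]
  exact hf.memLp.integrable (by simpa using hp.le)

namespace IntervalSeq
variable (I : IntervalSeq)

lemma exists_Ioc_subset : ∃ t : ℝ, ∀ n, Ioc (I.left n) (I.right n) ⊆ Ioc t (t + 1) := by
  obtain ⟨t, ht⟩ := I.period
  exact ⟨t, fun n => Ioc_subset_Ioc (ht n (left_mem_Icc.2 (I.le n))).1
    (ht n (right_mem_Icc.2 (I.le n))).2⟩

lemma pairwise_disjoint_Ioc : Pairwise fun m n =>
    Disjoint (Ioc (I.left m) (I.right m)) (Ioc (I.left n) (I.right n)) := by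
  intro m n hmn
  have h := I.nonoverlapping hmn
  simp only at h ⊢
  rw [interior_Icc, interior_Icc, Ioo_disjoint_Ioo] at h
  rwa [Ioc_disjoint_Ioc]

end IntervalSeq

/-- The increments of `g` over the intervals of `I`, sorted by length into dyadic levels. -/
lemma sum_increments_le {p p' r' θ α : ℝ} (hp : p.HolderConjugate p')
    (hr : r'.HolderConjugate (1 / θ)) (hθ : θ = α - 1 / p) {g : ℝ → ℝ} (hg : Continuous g)
    (hper : Function.Periodic g 1) {M : ℝ≥0}
    (hM : ∀ h ∈ Ioc (0 : ℝ) 1, ∫⁻ x in Ioc (0 : ℝ) 1, ‖g (x + h) - g x‖ₑ ^ p ≤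
      (M * ENNReal.ofReal (h ^ α)) ^ p) (I : IntervalSeq) {w : ℕ → ℝ≥0∞}
    (hw : Antitone fun k => w (k + 1)) (s : Finset ℕ) :
    ∑ k ∈ s, ENNReal.ofReal |g (I.right k) - g (I.left k)| * w (k + 1) ≤
      ENNReal.ofReal ((4 / (1 - (1 / 2) ^ (θ / 2))) * (2 / (θ / 2 * p)) ^ (1 / p)) * M *
        (1 - (2⁻¹ : ℝ≥0∞) ^ θ)⁻¹ * 4 ^ θ *
      (∑' n : ℕ, (((2⁻¹ : ℝ≥0∞) ^ n) ^ θ *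
        (∑ k ∈ Finset.Icc (2 ^ n) (2 ^ (n + 1)), w k ^ p') ^ (1 / p')) ^ r') ^ (1 / r') := by
  have hθ0 : 0 < θ := one_div_pos.1 hr.symm.pos
  obtain ⟨t, ht⟩ := I.exists_Ioc_subset
  -- Degenerate intervals have no level and no increment.
  set S := s.filter fun k => I.left k < I.right k with hS
  have hlt : ∀ k ∈ S, I.left k < I.right k := fun k hk => (Finset.mem_filter.1 hk).2
  have hlevel : ∀ k, ∃ n : ℕ, I.left k < I.right k →
      (1 / 2 : ℝ) ^ (n + 1) < I.right k - I.left k ∧ I.right k - I.left k ≤ (1 / 2) ^ n := by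
    intro k
    by_cases hk : I.left k < I.right k
    · have h1 := (Ioc_subset_Ioc_iff hk).1 (ht k)
      obtain ⟨n, hn⟩ := exists_nat_pow_near_of_lt_one (sub_pos.2 hk)
        (by linarith [h1.1, h1.2]) (by norm_num : (0 : ℝ) < 1 / 2) (by norm_num)
      exact ⟨n, fun _ => hn⟩
    · exact ⟨0, fun h => absurd h hk⟩
  choose κ hκ using hlevel
  have hb : (2⁻¹ : ℝ≥0∞) = ENNReal.ofReal (1 / 2) := by
    rw [one_div, ENNReal.ofReal_inv_of_pos two_pos]; simp
  have hsum : ∑ k ∈ S, (2⁻¹ : ℝ≥0∞) ^ κ k ≤ 2 := by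
    have h1 : ∑ k ∈ S, volume (Ioc (I.left k) (I.right k)) ≤ 1 := by
      rw [← measure_biUnion_finset (fun i _ j _ hij => I.pairwise_disjoint_Ioc hij)
        fun _ _ => measurableSet_Ioc]
      refine (measure_mono (iUnion₂_subset fun k _ => ht k)).trans ?_
      simp
    calc ∑ k ∈ S, (2⁻¹ : ℝ≥0∞) ^ κ k ≤ ∑ k ∈ S, 2 * volume (Ioc (I.left k) (I.right k)) := by
          refine Finset.sum_le_sum fun k hk => ?_
          have h2 := (hκ k (hlt k hk)).1
          rw [Real.volume_Ioc, hb, ← ENNReal.ofReal_pow (by norm_num),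
            ← ENNReal.ofReal_ofNat 2, ← ENNReal.ofReal_mul (by norm_num)]
          apply ENNReal.ofReal_le_ofReal
          rw [pow_succ] at h2
          linarith
      _ ≤ 2 := by
          rw [← Finset.mul_sum]
          simpa using mul_le_mul_right h1 2
  calc ∑ k ∈ s, ENNReal.ofReal |g (I.right k) - g (I.left k)| * w (k + 1)
      = ∑ k ∈ S, ENNReal.ofReal |g (I.right k) - g (I.left k)| * w (k + 1) := by
        refine (Finset.sum_subset (Finset.filter_subset _ _) fun k hks hk => ?_).symm
        have : I.left k = I.right k := le_antisymm (I.le k)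
          (not_lt.1 fun h => hk (Finset.mem_filter.2 ⟨hks, h⟩))
        simp [this]
    _ ≤ _ := by
        refine sum_mul_le_of_levels hp hr hw S κ (fun j => ?_) hsum
        have hθθ : θ / 2 < α - 1 / p := by linarith
        have hdiff : α - 1 / p - θ / 2 = θ / 2 := by rw [← hθ]; ring
        have := sum_abs_sub_rpow_le hg hper hp.lt (half_pos hθ0) hθθ hM
          (h := (1 / 2) ^ j) (by positivity) (pow_le_one₀ (by norm_num) (by norm_num)) (t := t)
          (S.filter (κ · = j)) (a := I.left) (b := I.right)
          (fun k hk => hlt k (Finset.mem_filter.1 hk).1)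
          (fun k hk => by
            obtain ⟨h1, rfl⟩ := Finset.mem_filter.1 hk
            exact (hκ k (hlt k h1)).2)
          (fun k _ => ht k) (fun i _ j _ hij => I.pairwise_disjoint_Ioc hij)
        rw [hdiff, ← hθ] at this
        rwa [hb, ← ENNReal.ofReal_pow (by norm_num), ENNReal.ofReal_rpow_of_pos (by positivity)]

/-- On a dyadic block the factor `2 ^ (-n θ)` may be replaced by `k ^ (-θ)`. -/
lemma tsum_dyadic_weights_le {p' r' θ : ℝ} (hp' : 0 < p') (hr' : 0 < r') (hθ : 0 < θ) {lam : ℕ → ℝ}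
    (hlam : ∀ n, 1 ≤ n → 0 < lam n) :
    (∑' n : ℕ, (((2⁻¹ : ℝ≥0∞) ^ n) ^ θ * (∑ k ∈ Finset.Icc ((2 : ℕ) ^ n) (2 ^ (n + 1)),
      ENNReal.ofReal (1 / lam k) ^ p') ^ (1 / p')) ^ r') ^ (1 / r') ≤
    2 ^ θ * (∑' n : ℕ, (∑ k ∈ Finset.Icc ((2 : ℕ) ^ n) (2 ^ (n + 1)),
      ENNReal.ofReal ((1 / ((k : ℝ) ^ θ * lam k)) ^ p')) ^ (r' / p')) ^ (1 / r') := by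
  have hb : (2⁻¹ : ℝ≥0∞) = ENNReal.ofReal (1 / 2) := by
    rw [one_div, ENNReal.ofReal_inv_of_pos two_pos]; simp
  have h2 : (2 : ℝ≥0∞) ^ θ = ENNReal.ofReal (2 ^ θ) := by
    rw [← ENNReal.ofReal_rpow_of_pos two_pos]; simp
  have key : ∀ n : ℕ, ((2⁻¹ : ℝ≥0∞) ^ n) ^ θ * (∑ k ∈ Finset.Icc ((2 : ℕ) ^ n) (2 ^ (n + 1)),
      ENNReal.ofReal (1 / lam k) ^ p') ^ (1 / p') ≤
      2 ^ θ * (∑ k ∈ Finset.Icc ((2 : ℕ) ^ n) (2 ^ (n + 1)),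
        ENNReal.ofReal ((1 / ((k : ℝ) ^ θ * lam k)) ^ p')) ^ (1 / p') := fun n => by
    have hout : ∀ c X : ℝ≥0∞, c * X ^ (1 / p') = (c ^ p' * X) ^ (1 / p') := fun c X => by
      rw [ENNReal.mul_rpow_of_nonneg _ _ (by positivity), ← ENNReal.rpow_mul,
        mul_one_div_cancel hp'.ne', ENNReal.rpow_one]
    rw [hout, hout, Finset.mul_sum, Finset.mul_sum]
    refine ENNReal.rpow_le_rpow (Finset.sum_le_sum fun k hk => ?_) (by positivity)
    obtain ⟨hk1, hk2⟩ := Finset.mem_Icc.1 hk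
    have hk0 : 1 ≤ k := Nat.one_le_two_pow.trans hk1
    have hl := hlam k hk0
    have hkpos : (0 : ℝ) < k := by exact_mod_cast hk0
    rw [← ENNReal.ofReal_rpow_of_pos (by positivity), ← ENNReal.mul_rpow_of_nonneg _ _ hp'.le,
      ← ENNReal.mul_rpow_of_nonneg _ _ hp'.le]
    refine ENNReal.rpow_le_rpow ?_ hp'.le
    rw [hb, h2, ← ENNReal.ofReal_pow (by norm_num), ENNReal.ofReal_rpow_of_pos (by positivity),
      ← ENNReal.ofReal_mul (by positivity), ← ENNReal.ofReal_mul (by positivity)]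
    apply ENNReal.ofReal_le_ofReal
    have h3 : ((1 / 2 : ℝ) ^ n) ^ θ ≤ 2 ^ θ / (k : ℝ) ^ θ := by
      rw [← Real.div_rpow two_pos.le hkpos.le]
      refine Real.rpow_le_rpow (by positivity) ?_ hθ.le
      have h4 : (k : ℝ) ≤ 2 ^ (n + 1) := by exact_mod_cast hk2
      rw [one_div, inv_pow, le_div_iff₀ hkpos, inv_mul_le_iff₀ (by positivity)]
      rwa [pow_succ] at h4
    calc _ ≤ 2 ^ θ / (k : ℝ) ^ θ * (1 / lam k) := by gcongr
      _ = _ := by field_simp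
  calc _ ≤ (∑' n : ℕ, (2 ^ θ * (∑ k ∈ Finset.Icc ((2 : ℕ) ^ n) (2 ^ (n + 1)),
        ENNReal.ofReal ((1 / ((k : ℝ) ^ θ * lam k)) ^ p')) ^ (1 / p')) ^ r') ^ (1 / r') :=
        ENNReal.rpow_le_rpow (ENNReal.tsum_le_tsum fun n => ENNReal.rpow_le_rpow (key n) hr'.le)
          (by positivity)
    _ = _ := by
        simp only [ENNReal.mul_rpow_of_nonneg _ _ hr'.le, ← ENNReal.rpow_mul, one_div_mul_eq_div]
        rw [ENNReal.tsum_mul_left, ENNReal.mul_rpow_of_nonneg _ _ (by positivity),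
          ← ENNReal.rpow_mul, mul_assoc, mul_one_div_cancel hr'.ne', mul_one]

end LambdaBV

theorem mainTheorem2 (p α : ℝ) (hp : 1 < p) (hα : 1 / p < α) (hα1 : α < 1)
    (p' r' : ℝ) (hp' : p' = p / (p - 1)) (hr' : r' = 1 / (1 + 1 / p - α)) :
    ∃ c : ℝ≥0, 0 < c ∧ ∀ lam : ℕ → ℝ, LambdaBV.IsWatermanSeq lam →
      ∀ f : ℝ → ℝ, LambdaBV.MemLip α p f →
        ∃ g : ℝ → ℝ, Continuous g ∧ Function.Periodic g 1 ∧ f =ᵐ[volume] g ∧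
          LambdaBV.lambdaVariation lam g ≤
            c * LambdaBV.lipNorm α p f *
              (∑' n : ℕ, (∑ k ∈ Finset.Icc ((2 : ℕ) ^ n) (2 ^ (n + 1)),
                ENNReal.ofReal ((1 / ((k : ℝ) ^ (α - 1 / p) * lam k)) ^ p')) ^ (r' / p'))
                  ^ (1 / r') := by
  obtain ⟨θ, hθ⟩ : ∃ θ, θ = α - 1 / p := ⟨_, rfl⟩
  have hp0 : 0 < p := by linarith
  have hθ0 : 0 < θ := hθ ▸ sub_pos.2 hα
  have hpp : p.HolderConjugate p' := hp' ▸ Real.HolderConjugate.conjExponent hp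
  have hθ1 : θ < 1 := by
    have : 0 < 1 / p := by positivity
    linarith
  have hrr : r'.HolderConjugate (1 / θ) := by
    have h1 : 1 + 1 / p - α = 1 - θ := by rw [hθ]; ring
    rw [h1] at hr'
    rw [Real.holderConjugate_iff, hr', one_lt_div (by linarith)]
    exact ⟨by linarith, by simp⟩
  set K : ℝ≥0∞ := ENNReal.ofReal ((4 / (1 - (1 / 2) ^ (θ / 2))) * (2 / (θ / 2 * p)) ^ (1 / p)) *
    (1 - (2⁻¹ : ℝ≥0∞) ^ θ)⁻¹ * 4 ^ θ * 2 ^ θ with hK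
  have hKtop : K ≠ ⊤ := by
    have h1 : (2⁻¹ : ℝ≥0∞) ^ θ < 1 := ENNReal.rpow_lt_one (by simp) hθ0
    refine ENNReal.mul_ne_top (ENNReal.mul_ne_top (ENNReal.mul_ne_top ENNReal.ofReal_ne_top ?_) ?_) ?_
    · exact ENNReal.inv_ne_top.2 (tsub_pos_of_lt h1).ne'
    · exact ENNReal.rpow_ne_top_of_nonneg hθ0.le (by simp)
    · exact ENNReal.rpow_ne_top_of_nonneg hθ0.le (by simp)
  refine ⟨K.toNNReal + 1, by positivity, fun lam hlam f hf => ?_⟩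
  have hMf := fun h (hh : h ∈ Ioc (0 : ℝ) 1) => hf.lintegral_shift_le_lipNorm hp hh
  obtain ⟨g, hg, hgper, hfg⟩ := LambdaBV.exists_continuous_periodic_ae_eq
    (hf.intervalIntegrable hp) hf.periodic hp hα hMf
  refine ⟨g, hg, hgper, hfg, ?_⟩
  have hMg : ∀ h ∈ Ioc (0 : ℝ) 1, ∫⁻ x in Ioc (0 : ℝ) 1, ‖g (x + h) - g x‖ₑ ^ p ≤
      ((LambdaBV.lipNorm α p f).toNNReal * ENNReal.ofReal (h ^ α)) ^ p := fun h hh => by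
    refine le_of_eq_of_le (lintegral_congr_ae (ae_restrict_of_ae ?_)) (hMf h hh)
    have hfgh := (measurePreserving_add_right volume h).quasiMeasurePreserving.ae_eq_comp hfg
    filter_upwards [hfg, hfgh] with x hx hxh
    simp only [Function.comp] at hxh
    rw [hx, hxh]
  have hw : Antitone fun k : ℕ => ENNReal.ofReal (1 / lam (k + 1)) := fun i j hij =>
    ENNReal.ofReal_le_ofReal (one_div_le_one_div_of_le (hlam.pos _ (by omega))
      (hlam.mono _ _ (by omega) (by omega)))
  refine iSup_le fun I => ?_
  rw [ENNReal.tsum_eq_iSup_sum]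
  refine iSup_le fun s => ?_
  have h1 := LambdaBV.sum_increments_le hpp hrr hθ hg hgper hMg I
    (w := fun k => ENNReal.ofReal (1 / lam k)) hw s
  have h2 := LambdaBV.tsum_dyadic_weights_le hpp.symm.pos hrr.pos hθ0 hlam.pos
  rw [ENNReal.coe_toNNReal hf.lipNorm_ne_top] at h1
  rw [← hθ]
  have h3 := h1.trans (mul_le_mul_right h2 _)
  generalize (∑' n : ℕ, (∑ k ∈ Finset.Icc ((2 : ℕ) ^ n) (2 ^ (n + 1)),
    ENNReal.ofReal ((1 / ((k : ℝ) ^ θ * lam k)) ^ p')) ^ (r' / p')) ^ (1 / r') = W at h3 ⊢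
  calc _ = ∑ k ∈ s, ENNReal.ofReal |g (I.right k) - g (I.left k)| *
        ENNReal.ofReal (1 / lam (k + 1)) := by
        refine Finset.sum_congr rfl fun k _ => ?_
        rw [← ENNReal.ofReal_mul (abs_nonneg _), mul_one_div]
    _ ≤ K * LambdaBV.lipNorm α p f * W := h3.trans_eq (by rw [hK]; ring)
    _ ≤ _ := by
        gcongr
        rw [ENNReal.coe_add, ENNReal.coe_toNNReal hKtop]
        exact le_self_add
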